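/- Let $f\colon[0,\infty)\to[0,\infty)$ satisfy: (M) $f$ is continuous and nondecreasing, and $f(u)>0$ for all $u>0$; (S) there is $\tau_0>0$ such that $f\in C^1([\tau_0,\infty))$ and $\int_{\tau_0}^\infty \frac{ds}{f(s)}<\infty$; (C) there is $\tau_1\ge 0$ such that $f$ is convex in $[\tau_1,\infty)$. Put $F(u)=\int_u^\infty \frac{ds}{f(s)}$ for $u>0$ and $F(0)=\lim_{u\to0^+}F(u)\in(0,\infty]$. For $N\ge1$ and $0<\theta\le2$ let $\Gamma_\theta$ be the fundamental solution of $\partial_t u+(-\Delta)^{\theta/2}u=0$ in $\mathbb R^N\times(0,\infty)$, that is, $\Gamma_\theta(x,t)=(2\pi)^{-N}\int_{\mathbb R^N}e^{ix\cdot\xi-t|\xi|^\theta}\,d\xi$; put $[S(t)\varphi](x)=\int_{\mathbb R^N}\Gamma_\theta(x-y,t)\varphi(y)\,dy\in[0,\infty]$ for measurable $\varphi\ge0$, and $Q_T=\mathbb R^N\times(0,T)$. For a nonnegative locally integrable function $\mu$ on $\mathbb R^N$, a solution in $Q_T$ of $$\partial_t u+(-\Delta)^{\theta/2}u=f(u),\qquad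 u(\cdot,0)=\mu,$$ is a nonnegative, measurable, almost everywhere finite function $u$ in $Q_T$ such that $$u(x,t)=[S(t)\mu](x)+\int_0^t[S(t-s)f(u(\cdot,s))](x)\,ds\qquad\text{for a.a. }(x,t)\in Q_T.$$ Then there exist $C_*\in(0,1)$ and $T_0>0$, depending only on $f$, such that for all $N\ge1$, $0<\theta\le2$, $T>0$ and all nonnegative locally integrable $\mu$ on $\mathbb R^N$: if the problem has a solution in $Q_T$, then, with $T_*=\min\{T,T_0\}$, $$[S(t)\mu](x)<\infty\quad\text{and}\quad F\big([S(t)\mu](x)\big)\ge C_*\,t\qquad\text{for a.a. }(x,t)\in Q_{T_*}.$$ -/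

import Mathlib

open MeasureTheory Set
open scoped ENNReal FourierTransform

noncomputable section

namespace FracHeat

/-- The fundamental solution `Γ_θ(x, t)` of `∂ₜ u + (-Δ)^{θ/2} u = 0` in `ℝ^N × (0, ∞)`: the function
whose Fourier transform in `x` is `exp (-t |ζ|^θ)`, where the frequency is `ζ = 2πξ` in Mathlib's
normalisation of the Fourier transform, i.e.
`Γ_θ(x, t) = (2π)^{-N} ∫ exp (i x·ζ) exp (-t |ζ|^θ) dζ`. The integral is real; `re` only changes
the type. -/
def kernel {N : ℕ} (θ : ℝ) (x : EuclideanSpace ℝ (Fin N)) (t : ℝ) : ℝ :=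
  ((𝓕⁻ (fun ξ : EuclideanSpace ℝ (Fin N) =>
    ((Real.exp (-t * (2 * Real.pi * ‖ξ‖) ^ θ) : ℝ) : ℂ))) x).re

/-- `[S(t)φ](x) = ∫ Γ_θ(x - y, t) φ(y) dy` for nonnegative `φ`, with values in `[0, ∞]`. -/
def semigroup {N : ℕ} (θ t : ℝ) (φ : EuclideanSpace ℝ (Fin N) → ℝ≥0∞)
    (x : EuclideanSpace ℝ (Fin N)) : ℝ≥0∞ :=
  ∫⁻ y, ENNReal.ofReal (kernel θ (x - y) t) * φ y

/-- `Q_T = ℝ^N × (0, T)`. -/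
def cylinder (N : ℕ) (T : ℝ) : Set (EuclideanSpace ℝ (Fin N) × ℝ) :=
  univ ×ˢ Ioo 0 T

/-- `L^{1,+}_loc(ℝ^N)`: locally integrable functions that are nonnegative (almost everywhere). -/
def IsInitialDatum {N : ℕ} (μ : EuclideanSpace ℝ (Fin N) → ℝ) : Prop :=
  LocallyIntegrable μ ∧ ∀ᵐ x, 0 ≤ μ x

/-- `u` is a solution in `Q_T` of `∂ₜ u + (-Δ)^{θ/2} u = f(u)`, `u(·, 0) = μ`: it is nonnegative,
(Lebesgue) measurable and finite almost everywhere in `Q_T`, and for almost all `(x, t) ∈ Q_T`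
`u(x, t) = [S(t)μ](x) + ∫₀ᵗ [S(t - s) f(u(·, s))](x) ds`. -/
structure IsSolution {N : ℕ} (θ : ℝ) (f : ℝ → ℝ) (μ : EuclideanSpace ℝ (Fin N) → ℝ) (T : ℝ)
    (u : EuclideanSpace ℝ (Fin N) × ℝ → ℝ≥0∞) : Prop where
  aemeasurable : AEMeasurable u (volume.restrict (cylinder N T))
  finite : ∀ᵐ p ∂(volume.restrict (cylinder N T)), u p < ∞
  eq : ∀ᵐ p ∂(volume.restrict (cylinder N T)),
    u p = semigroup θ p.2 (fun y => ENNReal.ofReal (μ y)) p.1 +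
      ∫⁻ s in Ioo 0 p.2,
        semigroup θ (p.2 - s) (fun y => ENNReal.ofReal (f (u (y, s)).toReal)) p.1

/-- The Cauchy problem has a solution in `Q_T`. -/
def SolvableIn {N : ℕ} (θ : ℝ) (f : ℝ → ℝ) (μ : EuclideanSpace ℝ (Fin N) → ℝ) (T : ℝ) : Prop :=
  ∃ u : EuclideanSpace ℝ (Fin N) × ℝ → ℝ≥0∞, IsSolution θ f μ T u

/-- (M): `f : [0, ∞) → [0, ∞)` is continuous, nondecreasing, and positive on `(0, ∞)`.
Only the values of `f` on `[0, ∞)` matter. -/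
structure CondM (f : ℝ → ℝ) : Prop where
  nonneg : ∀ u, 0 ≤ u → 0 ≤ f u
  continuousOn : ContinuousOn f (Ici 0)
  monotoneOn : MonotoneOn f (Ici 0)
  pos : ∀ u, 0 < u → 0 < f u

/-- (S): for some `τ₀ > 0`, `f ∈ C¹([τ₀, ∞))` and `∫_{τ₀}^∞ ds / f(s) < ∞`. -/
def CondS (f : ℝ → ℝ) : Prop :=
  ∃ τ₀ : ℝ, 0 < τ₀ ∧ ContDiffOn ℝ 1 f (Ici τ₀) ∧ IntegrableOn (fun s => 1 / f s) (Ioi τ₀)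

/-- (C): for some `τ₁ ≥ 0`, `f` is convex in `[τ₁, ∞)`. -/
def CondC (f : ℝ → ℝ) : Prop :=
  ∃ τ₁ : ℝ, 0 ≤ τ₁ ∧ ConvexOn ℝ (Ici τ₁) f

/-- `F(u) = ∫_u^∞ ds / f(s)` for `u ≥ 0`, with values in `[0, ∞]`. Under (M) and (S) it is finite
for `u > 0`, and its value at `0` is `F₀ = lim_{u → 0} F(u)` (finite or infinite). -/
def F (f : ℝ → ℝ) (u : ℝ) : ℝ≥0∞ :=
  ∫⁻ s in Ioi u, (ENNReal.ofReal (f s))⁻¹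

end FracHeat

end

/-! Fix $(x,t)$ where the integral equation holds with $u(x,t)<\infty$, and put
$W(s)=[S(t-s)u(\cdot,s)](x)$. Applying $S(t-s)$ to the equation at time $s$ gives
$W(s)=a+\int_0^s[S(t-r)f(u(\cdot,r))](x)\,dr$ with $a=[S(t)\mu](x)$, bounded by $u(x,t)$. If $g\le
f$ is convex, Jensen's inequality for the probability density $\Gamma_\theta(x-\cdot,t-s)$ gives
$W'\ge g(W)$ a.e.; as $W$ stays finite up to $t$, comparison with the ODE gives $t\le\int_a^\infty
ds/g$ (`ofReal_le_lintegral_of_solution`).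

Since $f$ is convex only near infinity, take $g(u)=f(\max(u,\tau))-f(\tau)$. It is at least $f/2$
beyond some $\tau_2$, so $t\le 2F(a)$ for $a\ge\tau_2$; for $a\le\tau_2$, $F(a)$ has a fixed
positive lower bound, and $t$ small suffices.

The kernel must be nonnegative, have mass one and satisfy the semigroup law. The last two follow
from Fourier inversion once nonnegativity is known. Nonnegativity holds because $e^{-t|\xi|^\theta}$
is a limit of polynomials in Gaussians with nonnegative coefficients: $1-(1-z)^{\theta/2}$ has
nonnegative Taylor coefficients, and $n(1-e^{-|\xi|^2/n})\to|\xi|^2$. -/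

noncomputable section

namespace FracHeat

open Filter Topology

/-! ### Fourier analysis of even functions; positivity by Gaussian approximation -/

section CosineTransform

variable {V : Type*} [NormedAddCommGroup V] [InnerProductSpace ℝ V] [FiniteDimensional ℝ V]
  [MeasurableSpace V] [BorelSpace V]

/-- The Fourier transform of an even function, written as a cosine integral. -/
def cosTransform (h : V → ℝ) (x : V) : ℝ :=
  ∫ ξ, h ξ * Real.cos (2 * Real.pi * inner ℝ ξ x)

theorem integrable_mul_cos {h : V → ℝ} (hi : Integrable h) (x : V) :
    Integrable (fun ξ => h ξ * Real.cos (2 * Real.pi * inner ℝ ξ x)) := by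
  refine hi.mul_bdd (c := 1) (by fun_prop) (ae_of_all _ fun ξ => ?_)
  simpa using Real.abs_cos_le_one _

theorem integrable_mul_sin {h : V → ℝ} (hi : Integrable h) (x : V) :
    Integrable (fun ξ => h ξ * Real.sin (2 * Real.pi * inner ℝ ξ x)) := by
  refine hi.mul_bdd (c := 1) (by fun_prop) (ae_of_all _ fun ξ => ?_)
  simpa using Real.abs_sin_le_one _

theorem integral_mul_sin_eq_zero {h : V → ℝ} (he : ∀ ξ, h (-ξ) = h ξ) (x : V) :
    ∫ ξ, h ξ * Real.sin (2 * Real.pi * inner ℝ ξ x) = 0 := by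
  have h1 := integral_neg_eq_self (fun ξ => h ξ * Real.sin (2 * Real.pi * inner ℝ ξ x)) volume
  simp only [he, inner_neg_left, mul_neg, Real.sin_neg, integral_neg] at h1
  linarith

theorem fourierInv_ofReal_eq_cosTransform {h : V → ℝ} (hi : Integrable h)
    (he : ∀ ξ, h (-ξ) = h ξ) (x : V) :
    𝓕⁻ (fun ξ => (h ξ : ℂ)) x = (cosTransform h x : ℂ) := by
  rw [Real.fourierInv_eq']
  have h1 : (fun v : V => Complex.exp (↑(2 * Real.pi * inner ℝ v x) * Complex.I) • (h v : ℂ)) =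
      fun v => ((h v * Real.cos (2 * Real.pi * inner ℝ v x) : ℝ) : ℂ) +
        ((h v * Real.sin (2 * Real.pi * inner ℝ v x) : ℝ) : ℂ) * Complex.I := by
    funext v
    rw [Complex.exp_mul_I, smul_eq_mul]
    push_cast
    ring
  rw [h1, integral_add ((integrable_mul_cos hi x).ofReal)
    (((integrable_mul_sin hi x).ofReal).mul_const _), integral_mul_const,
    integral_complex_ofReal, integral_complex_ofReal, integral_mul_sin_eq_zero he]
  simp [cosTransform]

theorem fourier_ofReal_eq_cosTransform {h : V → ℝ} (hi : Integrable h)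
    (he : ∀ ξ, h (-ξ) = h ξ) (x : V) :
    𝓕 (fun ξ => (h ξ : ℂ)) x = (cosTransform h x : ℂ) := by
  have h1 := fourierInv_ofReal_eq_cosTransform hi he (-x)
  rw [Real.fourierInv_eq_fourier_neg, neg_neg] at h1
  rw [h1]
  simp [cosTransform]

theorem cosTransform_neg (h : V → ℝ) (x : V) : cosTransform h (-x) = cosTransform h x := by
  simp [cosTransform]

theorem continuous_cosTransform {h : V → ℝ} (hi : Integrable h) :
    Continuous (cosTransform h) := by
  refine continuous_of_dominated (bound := fun ξ => ‖h ξ‖)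
    (fun x => (integrable_mul_cos hi x).aestronglyMeasurable) (fun x => ae_of_all _ fun ξ => ?_)
    hi.norm (ae_of_all _ fun ξ => by fun_prop)
  rw [norm_mul]
  exact mul_le_of_le_one_right (norm_nonneg _) (by simpa using Real.abs_cos_le_one _)

/-- Fourier inversion for even functions. -/
theorem cosTransform_cosTransform {h : V → ℝ} (hi : Integrable h) (hc : Continuous h)
    (he : ∀ ξ, h (-ξ) = h ξ) (hi' : Integrable (cosTransform h)) :
    cosTransform (cosTransform h) = h := by
  have hI : Integrable (𝓕 (fun ξ => (h ξ : ℂ))) := by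
    rw [funext (fourier_ofReal_eq_cosTransform hi he)]
    exact hi'.ofReal
  have h1 := Continuous.fourier_fourierInv_eq (f := fun ξ => (h ξ : ℂ)) (by fun_prop) hi.ofReal hI
  rw [funext (fourierInv_ofReal_eq_cosTransform hi he)] at h1
  funext ξ
  have h2 := congrFun h1 ξ
  rw [fourier_ofReal_eq_cosTransform hi' (cosTransform_neg h)] at h2
  exact_mod_cast h2

theorem integrable_gaussian {b : ℝ} (hb : 0 < b) :
    Integrable (fun v : V => Real.exp (-b * ‖v‖ ^ 2)) := by
  have h1 := (GaussianFourier.integrable_cexp_neg_mul_sq_norm_add (V := V) (b := (b : ℂ))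
    (by simpa using hb) 0 0).re
  refine h1.congr (ae_of_all _ fun v => ?_)
  have : Complex.exp (-(b : ℂ) * (‖v‖ : ℂ) ^ 2 + 0 * ((inner ℝ (0 : V) v : ℝ) : ℂ)) =
      ((Real.exp (-b * ‖v‖ ^ 2) : ℝ) : ℂ) := by
    push_cast
    simp
  exact (congrArg Complex.re this).trans (Complex.ofReal_re _)

theorem cosTransform_gaussian {b : ℝ} (hb : 0 < b) (x : V) :
    cosTransform (fun v : V => Real.exp (-b * ‖v‖ ^ 2)) x =
      (Real.pi / b) ^ (Module.finrank ℝ V / 2 : ℝ) * Real.exp (-(Real.pi ^ 2 / b) * ‖x‖ ^ 2) := by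
  have h1 := fourier_ofReal_eq_cosTransform (integrable_gaussian (V := V) hb) (by simp) x
  have h2 := fourier_gaussian_innerProductSpace (V := V) (b := (b : ℂ)) (by simpa using hb) x
  have h3 : (fun v : V => ((Real.exp (-b * ‖v‖ ^ 2) : ℝ) : ℂ)) =
      fun v => Complex.exp (-(b : ℂ) * ‖v‖ ^ 2) := by
    funext v; push_cast; rfl
  rw [h3, h2] at h1
  have h4 : ((Real.pi : ℂ) / b) ^ (Module.finrank ℝ V / 2 : ℂ) =
      (((Real.pi / b) ^ (Module.finrank ℝ V / 2 : ℝ) : ℝ) : ℂ) := by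
    rw [Complex.ofReal_cpow (by positivity)]
    push_cast
    rfl
  have h5 : Complex.exp (-(Real.pi : ℂ) ^ 2 * ‖x‖ ^ 2 / b) =
      ((Real.exp (-(Real.pi ^ 2 / b) * ‖x‖ ^ 2) : ℝ) : ℂ) := by
    push_cast
    congr 1
    ring
  rw [h4, h5] at h1
  exact_mod_cast h1.symm

theorem cosTransform_gaussian_nonneg {b : ℝ} (hb : 0 < b) (x : V) :
    0 ≤ cosTransform (fun v : V => Real.exp (-b * ‖v‖ ^ 2)) x := by
  rw [cosTransform_gaussian hb]
  positivity

theorem integrable_cosTransform_gaussian {b : ℝ} (hb : 0 < b) :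
    Integrable (cosTransform (fun v : V => Real.exp (-b * ‖v‖ ^ 2))) := by
  rw [funext (cosTransform_gaussian hb)]
  exact (integrable_gaussian (by positivity)).const_mul _

theorem integral_cosTransform_gaussian {b : ℝ} (hb : 0 < b) :
    ∫ x, cosTransform (fun v : V => Real.exp (-b * ‖v‖ ^ 2)) x = 1 := by
  have h1 := congrFun (cosTransform_cosTransform (integrable_gaussian (V := V) hb) (by fun_prop)
    (by simp) (integrable_cosTransform_gaussian hb)) 0
  simpa [cosTransform] using h1

/-- The Fourier transform is symmetric. -/
theorem integral_cosTransform_mul {g h : V → ℝ} (hg : Integrable g) (hh : Integrable h) :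
    ∫ x, cosTransform h x * g x = ∫ ξ, h ξ * cosTransform g ξ := by
  simp only [cosTransform, ← integral_mul_const, ← integral_const_mul]
  rw [integral_integral_swap]
  · refine integral_congr_ae (ae_of_all _ fun x => integral_congr_ae (ae_of_all _ fun ξ => ?_))
    simp only
    rw [real_inner_comm]
    ring
  · have h1 : Integrable (fun p : V × V => g p.1 * h p.2) (volume.prod volume) := hg.mul_prod hh
    refine (h1.mul_bdd (c := 1) (g := fun p => Real.cos (2 * Real.pi * inner ℝ p.2 p.1))
      (by fun_prop) (ae_of_all _ fun ξ => ?_)).congr (ae_of_all _ fun p => ?_)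
    · simpa using Real.abs_cos_le_one _
    · simp only [Function.uncurry]
      ring

/-- A nonnegative Fourier transform of an integrable function bounded by one is integrable. -/
theorem integrable_cosTransform_of_nonneg {h : V → ℝ} (hi : Integrable h) (h1 : ∀ ξ, h ξ ≤ 1)
    (hpos : ∀ x, 0 ≤ cosTransform h x) : Integrable (cosTransform h) := by
  have hcont := continuous_cosTransform hi
  refine ⟨hcont.aestronglyMeasurable, ?_⟩
  rw [hasFiniteIntegral_iff_ofReal (ae_of_all _ hpos)]
  refine lt_of_le_of_lt (b := 1) ?_ ENNReal.one_lt_top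
  have hn : ∀ n : ℕ, (0 : ℝ) < 1 / ((n : ℝ) + 1) := fun n => Nat.one_div_pos_of_nat
  -- Symmetry of the transform moves it onto the Gaussian weight; since $h\le1$, the integral is at
  -- most that of the transformed Gaussian, which is 1. Fatou's lemma then removes the weight.
  have key : ∀ n : ℕ, ∫⁻ x, ENNReal.ofReal
      (cosTransform h x * Real.exp (-(1 / ((n : ℝ) + 1)) * ‖x‖ ^ 2)) ≤ 1 := by
    intro n
    have hb := hn n
    set b := 1 / ((n : ℝ) + 1)
    have hint : Integrable (fun x => cosTransform h x * Real.exp (-b * ‖x‖ ^ 2)) := by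
      refine (integrable_gaussian hb).bdd_mul (c := ∫ ξ, ‖h ξ‖) hcont.aestronglyMeasurable
        (ae_of_all _ fun x => ?_)
      refine (norm_integral_le_integral_norm _).trans
        (integral_mono (integrable_mul_cos hi x).norm hi.norm fun ξ => ?_)
      simp only [norm_mul]
      exact mul_le_of_le_one_right (norm_nonneg _) (by simpa using Real.abs_cos_le_one _)
    rw [← ofReal_integral_eq_lintegral_ofReal hint
      (ae_of_all _ fun x => mul_nonneg (hpos x) (Real.exp_nonneg _)),
      integral_cosTransform_mul (integrable_gaussian hb) hi, ← ENNReal.ofReal_one,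
      ← integral_cosTransform_gaussian (V := V) hb]
    refine ENNReal.ofReal_le_ofReal (integral_mono ?_ (integrable_cosTransform_gaussian hb) ?_)
    · simp_rw [cosTransform_gaussian hb]
      refine hi.mul_bdd
        (c := ‖(Real.pi / b) ^ (Module.finrank ℝ V / 2 : ℝ)‖) (by fun_prop)
        (ae_of_all _ fun x => ?_)
      rw [norm_mul]
      refine mul_le_of_le_one_right (norm_nonneg _) ?_
      rw [Real.norm_eq_abs, Real.abs_exp, Real.exp_le_one_iff, neg_mul]
      exact neg_nonpos.2 (by positivity)
    · exact fun x => mul_le_of_le_one_left (cosTransform_gaussian_nonneg hb x) (h1 x)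
  have hlim : ∀ x : V, Tendsto (fun n : ℕ => ENNReal.ofReal
      (cosTransform h x * Real.exp (-(1 / ((n : ℝ) + 1)) * ‖x‖ ^ 2))) atTop
      (𝓝 (ENNReal.ofReal (cosTransform h x))) := by
    intro x
    refine ENNReal.tendsto_ofReal ?_
    have h2 : Tendsto (fun n : ℕ => Real.exp (-(1 / ((n : ℝ) + 1)) * ‖x‖ ^ 2)) atTop
        (𝓝 (Real.exp (-0 * ‖x‖ ^ 2))) :=
      (Real.continuous_exp.tendsto _).comp
        ((tendsto_one_div_add_atTop_nhds_zero_nat.neg).mul_const _)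
    simpa using h2.const_mul (cosTransform h x)
  calc ∫⁻ x, ENNReal.ofReal (cosTransform h x)
      = ∫⁻ x, liminf (fun n : ℕ => ENNReal.ofReal
          (cosTransform h x * Real.exp (-(1 / ((n : ℝ) + 1)) * ‖x‖ ^ 2))) atTop :=
        lintegral_congr fun x => (hlim x).liminf_eq.symm
    _ ≤ liminf (fun n : ℕ => ∫⁻ x, ENNReal.ofReal
          (cosTransform h x * Real.exp (-(1 / ((n : ℝ) + 1)) * ‖x‖ ^ 2))) atTop :=
        lintegral_liminf_le fun n => by fun_prop
    _ ≤ 1 := by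
        refine (liminf_le_liminf (Eventually.of_forall key)).trans ?_
        simp

/-- Measurable functions with values in `[0, 1]` whose products with Gaussians have nonnegative
Fourier transforms. -/
structure PosType (h : V → ℝ) : Prop where
  meas : Measurable h
  nonneg : ∀ ξ, 0 ≤ h ξ
  le_one : ∀ ξ, h ξ ≤ 1
  pos : ∀ δ : ℝ, 0 < δ → ∀ x, 0 ≤ cosTransform (fun ξ => h ξ * Real.exp (-δ * ‖ξ‖ ^ 2)) x

/-- The Gaussian factor in `PosType.pos` is itself the dominating function, so the class is closed
under a.e. limits without any integrability of $h$ or $g_n$. -/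
theorem PosType.of_tendsto {h : V → ℝ} {g : ℕ → V → ℝ} (hg : ∀ n, PosType (g n))
    (hm : Measurable h) (h0 : ∀ ξ, 0 ≤ h ξ) (h1 : ∀ ξ, h ξ ≤ 1)
    (hlim : ∀ᵐ ξ, Tendsto (fun n => g n ξ) atTop (𝓝 (h ξ))) : PosType h := by
  refine ⟨hm, h0, h1, fun δ hδ x => ?_⟩
  refine ge_of_tendsto' (tendsto_integral_of_dominated_convergence
    (F := fun n ξ => g n ξ * Real.exp (-δ * ‖ξ‖ ^ 2) * Real.cos (2 * Real.pi * inner ℝ ξ x))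
    (fun ξ => Real.exp (-δ * ‖ξ‖ ^ 2)) (fun n => ?_) (integrable_gaussian hδ) (fun n => ?_) ?_)
    (fun n => (hg n).pos δ hδ x)
  · have := (hg n).meas
    exact Measurable.aestronglyMeasurable (by fun_prop)
  · refine ae_of_all _ fun ξ => ?_
    rw [norm_mul, norm_mul, Real.norm_of_nonneg ((hg n).nonneg ξ), Real.norm_eq_abs (Real.exp _),
      Real.abs_exp]
    refine (mul_le_of_le_one_right (by have := (hg n).nonneg ξ; positivity)
      (by simpa using Real.abs_cos_le_one _)).trans ?_
    exact mul_le_of_le_one_left (Real.exp_nonneg _) ((hg n).le_one ξ)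
  · filter_upwards [hlim] with ξ hξ
    exact (hξ.mul_const _).mul_const _

/-- Powers of a Gaussian are Gaussians, or constant; after multiplication by $e^{-\delta|\xi|^2}$
every term, the constant one included, has a nonnegative transform. -/
theorem PosType.of_polynomial (p : Polynomial NNReal) {a : ℝ} (ha : 0 ≤ a)
    (h1 : ∀ z : ℝ, 0 ≤ z → z ≤ 1 → p.eval₂ NNReal.toRealHom z ≤ 1) :
    PosType (fun ξ : V => p.eval₂ NNReal.toRealHom (Real.exp (-a * ‖ξ‖ ^ 2))) := by
  refine ⟨?_, fun ξ => ?_, fun ξ => h1 _ (Real.exp_nonneg _) ?_, fun δ hδ x => ?_⟩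
  · simp only [Polynomial.eval₂_eq_sum_range]
    fun_prop
  · simp only [Polynomial.eval₂_eq_sum_range]
    exact Finset.sum_nonneg fun i _ => mul_nonneg (NNReal.coe_nonneg _) (by positivity)
  · rw [Real.exp_le_one_iff, neg_mul]
    exact neg_nonpos.2 (by positivity)
  · have h2 : ∀ ξ : V, p.eval₂ NNReal.toRealHom (Real.exp (-a * ‖ξ‖ ^ 2)) *
        Real.exp (-δ * ‖ξ‖ ^ 2) * Real.cos (2 * Real.pi * inner ℝ ξ x) =
        ∑ i ∈ Finset.range (p.natDegree + 1), (p.coeff i : ℝ) *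
          (Real.exp (-(i * a + δ) * ‖ξ‖ ^ 2) * Real.cos (2 * Real.pi * inner ℝ ξ x)) := by
      intro ξ
      rw [Polynomial.eval₂_eq_sum_range, Finset.sum_mul, Finset.sum_mul]
      refine Finset.sum_congr rfl fun i _ => ?_
      have : Real.exp (-(i * a + δ) * ‖ξ‖ ^ 2) =
          Real.exp (-a * ‖ξ‖ ^ 2) ^ i * Real.exp (-δ * ‖ξ‖ ^ 2) := by
        rw [← Real.exp_nat_mul, ← Real.exp_add]
        congr 1
        ring
      rw [this]
      simp only [NNReal.coe_toRealHom]
      ring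
    have hpos : ∀ i : ℕ, 0 < i * a + δ := fun i => by positivity
    simp only [cosTransform, h2]
    rw [integral_finsetSum _ fun i _ =>
      (integrable_mul_cos (integrable_gaussian (hpos i)) x).const_mul _]
    refine Finset.sum_nonneg fun i _ => ?_
    rw [integral_const_mul]
    exact mul_nonneg (NNReal.coe_nonneg _) (cosTransform_gaussian_nonneg (hpos i) x)

theorem PosType.cosTransform_nonneg {h : V → ℝ} (hh : PosType h) (hi : Integrable h) (x : V) :
    0 ≤ cosTransform h x := by
  refine ge_of_tendsto' (tendsto_integral_of_dominated_convergence
    (F := fun (n : ℕ) ξ => h ξ * Real.exp (-(1 / ((n : ℝ) + 1)) * ‖ξ‖ ^ 2) *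
      Real.cos (2 * Real.pi * inner ℝ ξ x)) h (fun n => ?_) hi (fun n => ?_) ?_)
    (fun n => hh.pos _ Nat.one_div_pos_of_nat x)
  · have := hh.meas
    exact Measurable.aestronglyMeasurable (by fun_prop)
  · refine ae_of_all _ fun ξ => ?_
    rw [norm_mul, norm_mul, Real.norm_of_nonneg (hh.nonneg ξ), Real.norm_eq_abs (Real.exp _),
      Real.abs_exp]
    refine (mul_le_of_le_one_right (by have := hh.nonneg ξ; positivity)
      (by simpa using Real.abs_cos_le_one _)).trans ?_
    refine mul_le_of_le_one_right (hh.nonneg ξ) ?_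
    rw [Real.exp_le_one_iff, neg_mul]
    exact neg_nonpos.2 (by positivity)
  · refine ae_of_all _ fun ξ => ?_
    have h2 : Tendsto (fun n : ℕ => Real.exp (-(1 / ((n : ℝ) + 1)) * ‖ξ‖ ^ 2)) atTop
        (𝓝 (Real.exp (-0 * ‖ξ‖ ^ 2))) :=
      (Real.continuous_exp.tendsto _).comp
        ((tendsto_one_div_add_atTop_nhds_zero_nat.neg).mul_const _)
    simpa using (h2.const_mul (h ξ)).mul_const (Real.cos (2 * Real.pi * inner ℝ ξ x))

end CosineTransform

/-! ### Nonnegative Taylor coefficients of $1-(1-z)^\alpha$ -/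

section Binomial

theorem choose_succ_mul (α : ℝ) (k : ℕ) :
    Ring.choose α (k + 1) * (k + 1) = Ring.choose α k * (α - k) := by
  have hk : ((k.factorial : ℕ) : ℝ) ≠ 0 := by positivity
  rw [Ring.choose_eq_smul, Ring.choose_eq_smul, descPochhammer_succ_right, Polynomial.smeval_mul,
    Nat.factorial_succ]
  simp only [smul_eq_mul, Polynomial.smeval_sub, Polynomial.smeval_X, Polynomial.smeval_natCast]
  push_cast
  field_simp
  simp

/-- The first term is $-\alpha\le0$, and each later one is its predecessor times
$(k+1-\alpha)/(k+2)\ge0$. -/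
theorem neg_one_pow_mul_choose_nonpos {α : ℝ} (h0 : 0 ≤ α) (h1 : α ≤ 1) (k : ℕ) :
    (-1) ^ (k + 1) * Ring.choose α (k + 1) ≤ 0 := by
  induction k with
  | zero => simpa using h0
  | succ k ih =>
    have h2 := choose_succ_mul α (k + 1)
    push_cast at h2
    have h3 : (-1) ^ (k + 1 + 1) * Ring.choose α (k + 1 + 1) * ((k : ℝ) + 1 + 1) =
        ((-1) ^ (k + 1) * Ring.choose α (k + 1)) * (k + 1 - α) := by
      rw [mul_assoc, h2]
      ring
    have h4 : ((-1) ^ (k + 1) * Ring.choose α (k + 1)) * (k + 1 - α) ≤ 0 :=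
      mul_nonpos_of_nonpos_of_nonneg ih (by have : (0 : ℝ) ≤ k := k.cast_nonneg; linarith)
    rw [← h3] at h4
    exact nonpos_of_mul_nonpos_left h4 (by positivity)

/-- The coefficients of the power series of `1 - (1 - z) ^ α` at degree `k + 1`. -/
def powCoeff (α : ℝ) (k : ℕ) : ℝ := -((-1) ^ (k + 1) * Ring.choose α (k + 1))

theorem powCoeff_nonneg {α : ℝ} (h0 : 0 ≤ α) (h1 : α ≤ 1) (k : ℕ) : 0 ≤ powCoeff α k :=
  neg_nonneg.2 (neg_one_pow_mul_choose_nonpos h0 h1 k)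

theorem hasSum_powCoeff (α : ℝ) {z : ℝ} (hz0 : 0 ≤ z) (hz1 : z < 1) :
    HasSum (fun k => powCoeff α k * z ^ (k + 1)) (1 - (1 - z) ^ α) := by
  have h1 := (Real.one_add_rpow_hasFPowerSeriesOnBall_zero (a := α)).hasSum (y := -z) (by
    simp only [Metric.mem_eball, edist_zero_right, enorm_neg]
    rw [← ENNReal.ofReal_one, Real.enorm_of_nonneg hz0]
    exact (ENNReal.ofReal_lt_ofReal_iff one_pos).2 hz1)
  simp only [binomialSeries_apply, List.ofFn_const, List.prod_replicate, smul_eq_mul,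
    zero_add] at h1
  rw [← hasSum_nat_add_iff' 1] at h1
  have h2 := h1.neg
  simp only [Finset.range_one, Finset.sum_singleton, Ring.choose_zero_right, pow_zero, mul_one,
    neg_sub, ← sub_eq_add_neg] at h2
  refine h2.congr_fun fun k => ?_
  rw [powCoeff, neg_pow z]
  ring

/-- The partial sums of the power series of `1 - (1 - z) ^ α`. -/
def powPoly (α : ℝ) (M : ℕ) : Polynomial NNReal :=
  ∑ k ∈ Finset.range M, Polynomial.C (powCoeff α k).toNNReal * Polynomial.X ^ (k + 1)

theorem eval_powPoly {α : ℝ} (h0 : 0 ≤ α) (h1 : α ≤ 1) (M : ℕ) (z : ℝ) :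
    (powPoly α M).eval₂ NNReal.toRealHom z = ∑ k ∈ Finset.range M, powCoeff α k * z ^ (k + 1) := by
  simp only [powPoly, Polynomial.eval₂_finsetSum, Polynomial.eval₂_mul, Polynomial.eval₂_C,
    Polynomial.eval₂_X_pow, NNReal.coe_toRealHom, Real.coe_toNNReal _ (powCoeff_nonneg h0 h1 _)]

theorem eval_nonneg (p : Polynomial NNReal) {z : ℝ} (hz : 0 ≤ z) :
    0 ≤ p.eval₂ NNReal.toRealHom z := by
  rw [Polynomial.eval₂_eq_sum_range]
  exact Finset.sum_nonneg fun i _ => mul_nonneg (NNReal.coe_nonneg _) (by positivity)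

theorem eval_powPoly_le_one {α : ℝ} (h0 : 0 ≤ α) (h1 : α ≤ 1) (M : ℕ) {z : ℝ} (hz0 : 0 ≤ z)
    (hz1 : z ≤ 1) : (powPoly α M).eval₂ NNReal.toRealHom z ≤ 1 := by
  have hlt : ∀ z ∈ Ico (0 : ℝ) 1, ∑ k ∈ Finset.range M, powCoeff α k * z ^ (k + 1) ≤ 1 := by
    intro z hz
    refine (sum_le_hasSum _ (fun k _ => mul_nonneg (powCoeff_nonneg h0 h1 k) (pow_nonneg hz.1 _))
      (hasSum_powCoeff α hz.1 hz.2)).trans ?_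
    have := Real.rpow_nonneg (sub_nonneg.2 hz.2.le) α
    linarith
  rw [eval_powPoly h0 h1]
  -- The endpoint $z=1$, attained by the Gaussian at the origin, lies outside the ball of
  -- convergence and is reached by continuity of the partial sum.
  refine le_on_closure hlt (by fun_prop) continuousOn_const ?_
  rw [closure_Ico zero_ne_one]
  exact ⟨hz0, hz1⟩

end Binomial

/-! ### Positivity, mass and convolution law for the transform of $e^{-t|\xi|^\theta}$ -/

section StableTransform

set_option linter.unusedSectionVars false

variable {V : Type*} [NormedAddCommGroup V] [InnerProductSpace ℝ V] [FiniteDimensional ℝ V]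
  [MeasurableSpace V] [BorelSpace V]

theorem exp_gaussian_mem_Icc {a : ℝ} (ha : 0 ≤ a) (ξ : V) :
    Real.exp (-a * ‖ξ‖ ^ 2) ∈ Icc (0 : ℝ) 1 := by
  refine ⟨Real.exp_nonneg _, ?_⟩
  rw [Real.exp_le_one_iff, neg_mul]
  exact neg_nonpos.2 (by positivity)

/-- Expand $e^{-c(1-p)}=e^{-c}\sum_m (cp)^m/m!$: the truncations are again polynomials with
nonnegative coefficients, bounded by 1. -/
theorem PosType.exp_polynomial (p : Polynomial NNReal) {a c : ℝ} (ha : 0 ≤ a) (hc : 0 ≤ c)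
    (h1 : ∀ z : ℝ, 0 ≤ z → z ≤ 1 → p.eval₂ NNReal.toRealHom z ≤ 1) :
    PosType (fun ξ : V =>
      Real.exp (-c * (1 - p.eval₂ NNReal.toRealHom (Real.exp (-a * ‖ξ‖ ^ 2))))) := by
  let q : ℕ → Polynomial NNReal := fun J =>
    Polynomial.C (Real.exp (-c)).toNNReal *
      ∑ m ∈ Finset.range J, Polynomial.C (c ^ m / m.factorial).toNNReal * p ^ m
  have hq : ∀ J z, (q J).eval₂ NNReal.toRealHom z = Real.exp (-c) *
      ∑ m ∈ Finset.range J, (c * p.eval₂ NNReal.toRealHom z) ^ m / m.factorial := by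
    intro J z
    simp only [q, Polynomial.eval₂_mul, Polynomial.eval₂_finsetSum, Polynomial.eval₂_C,
      Polynomial.eval₂_pow, NNReal.coe_toRealHom, Real.coe_toNNReal _ (Real.exp_nonneg _)]
    congr 1
    refine Finset.sum_congr rfl fun m _ => ?_
    rw [Real.coe_toNNReal _ (by positivity), mul_pow]
    ring
  have hexp : ∀ z, Real.exp (-c * (1 - z)) = Real.exp (-c) * Real.exp (c * z) := by
    intro z
    rw [← Real.exp_add]
    congr 1
    ring
  have hmeas : Measurable fun ξ : V => p.eval₂ NNReal.toRealHom (Real.exp (-a * ‖ξ‖ ^ 2)) := by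
    simp only [Polynomial.eval₂_eq_sum_range]
    fun_prop
  refine PosType.of_tendsto (g := fun J ξ => (q J).eval₂ NNReal.toRealHom
    (Real.exp (-a * ‖ξ‖ ^ 2))) (fun J => PosType.of_polynomial (q J) ha fun z hz0 hz1 => ?_)
    (by fun_prop) (fun ξ => Real.exp_nonneg _) (fun ξ => ?_) (ae_of_all _ fun ξ => ?_)
  · rw [hq]
    have h2 := Real.sum_le_exp_of_nonneg (mul_nonneg hc (eval_nonneg p hz0)) J
    calc _ ≤ Real.exp (-c) * Real.exp (c * p.eval₂ NNReal.toRealHom z) := by gcongr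
      _ ≤ 1 := by
        rw [← hexp, Real.exp_le_one_iff, neg_mul]
        exact neg_nonpos.2 (mul_nonneg hc (sub_nonneg.2 (h1 z hz0 hz1)))
  · have hz := exp_gaussian_mem_Icc ha ξ
    rw [Real.exp_le_one_iff, neg_mul]
    exact neg_nonpos.2 (mul_nonneg hc (sub_nonneg.2 (h1 _ hz.1 hz.2)))
  · simp only [hq, hexp]
    refine Tendsto.const_mul _ ?_
    rw [Real.exp_eq_exp_ℝ]
    exact (NormedSpace.expSeries_div_hasSum_exp _).tendsto_sum_nat

theorem ae_ne_zero [Nontrivial V] : ∀ᵐ ξ : V, ξ ≠ 0 := by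
  rw [ae_iff]
  simp

/-- Replace $(1-z)^\alpha$ by one minus the partial sums of `powPoly`. The series is summed only
where $z<1$, that is for $\xi\ne0$; the origin is a null set. -/
theorem PosType.exp_rpow_gaussian [Nontrivial V] {a c α : ℝ} (ha : 0 < a) (hc : 0 ≤ c)
    (h0 : 0 ≤ α) (h1 : α ≤ 1) :
    PosType (fun ξ : V => Real.exp (-c * (1 - Real.exp (-a * ‖ξ‖ ^ 2)) ^ α)) := by
  refine PosType.of_tendsto (fun M => PosType.exp_polynomial (powPoly α M) ha.le hc
    fun z hz0 hz1 => eval_powPoly_le_one h0 h1 M hz0 hz1) (by fun_prop)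
    (fun ξ => Real.exp_nonneg _) (fun ξ => ?_) ?_
  · rw [Real.exp_le_one_iff, neg_mul]
    exact neg_nonpos.2 (mul_nonneg hc
      (Real.rpow_nonneg (sub_nonneg.2 (exp_gaussian_mem_Icc ha.le ξ).2) _))
  · filter_upwards [ae_ne_zero] with ξ hξ
    have hlt : Real.exp (-a * ‖ξ‖ ^ 2) < 1 := by
      rw [Real.exp_lt_one_iff, neg_mul]
      exact neg_lt_zero.2 (by positivity)
    have h2 := (hasSum_powCoeff α (Real.exp_nonneg _) hlt).tendsto_sum_nat
    simp only [eval_powPoly h0 h1]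
    have h3 := (h2.const_sub 1).const_mul (-c)
    rw [sub_sub_cancel] at h3
    exact (Real.continuous_exp.tendsto _).comp h3

theorem tendsto_nat_mul_one_sub_exp (lam : ℝ) :
    Tendsto (fun n : ℕ => (n : ℝ) * (1 - Real.exp (-(lam / n)))) atTop (𝓝 lam) := by
  have h1 : HasDerivAt (fun x : ℝ => 1 - Real.exp (-(lam * x))) lam 0 := by
    have := (((hasDerivAt_id (0 : ℝ)).const_mul lam).neg.exp).const_sub 1
    simpa using this
  have h2 := h1.tendsto_slope_zero_right
  have h3 : Tendsto (fun n : ℕ => ((n : ℝ))⁻¹) atTop (𝓝[>] 0) :=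
    tendsto_inv_atTop_nhdsGT_zero.comp tendsto_natCast_atTop_atTop
  refine (h2.comp h3).congr fun n => ?_
  simp [div_eq_mul_inv]

/-- The function `exp (-t |ξ| ^ θ)`, with `ξ` scaled as in Mathlib's Fourier transform. -/
def symbol (θ t : ℝ) (ξ : V) : ℝ := Real.exp (-t * (2 * Real.pi * ‖ξ‖) ^ θ)

theorem symbol_le_one (θ : ℝ) {t : ℝ} (ht : 0 ≤ t) (ξ : V) : symbol θ t ξ ≤ 1 := by
  rw [symbol, Real.exp_le_one_iff, neg_mul]
  exact neg_nonpos.2 (by positivity)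

theorem posType_symbol [Nontrivial V] {θ t : ℝ} (hθ : 0 < θ) (hθ2 : θ ≤ 2) (ht : 0 ≤ t) :
    PosType (symbol θ t : V → ℝ) := by
  have h0 : 0 ≤ θ / 2 := by positivity
  have h1 : θ / 2 ≤ 1 := by linarith
  -- The factor $n^{\theta/2}$ in $c$ turns the exponent into
  -- $-t\,[n(1-e^{-|2\pi\xi|^2/n})]^{\theta/2}$, whose limit is $-t|2\pi\xi|^\theta$; the index
  -- $n+1$ avoids division by zero.
  refine PosType.of_tendsto (fun n => PosType.exp_rpow_gaussian (V := V)
    (a := (2 * Real.pi) ^ 2 / ((n + 1 : ℕ) : ℝ)) (c := t * ((n + 1 : ℕ) : ℝ) ^ (θ / 2))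
    (by positivity) (by positivity) h0 h1) (by unfold symbol; fun_prop)
    (fun ξ => Real.exp_nonneg _) (symbol_le_one θ ht) (ae_of_all _ fun ξ => ?_)
  have h2 := ((tendsto_nat_mul_one_sub_exp ((2 * Real.pi * ‖ξ‖) ^ 2)).comp
    (tendsto_add_atTop_nat 1)).rpow_const (p := θ / 2) (Or.inr h0)
  have h3 : ((2 * Real.pi * ‖ξ‖) ^ 2) ^ (θ / 2) = (2 * Real.pi * ‖ξ‖) ^ θ := by
    rw [← Real.rpow_natCast, ← Real.rpow_mul (by positivity)]
    congr 1
    push_cast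
    ring
  rw [h3] at h2
  refine ((Real.continuous_exp.tendsto _).comp (h2.const_mul (-t))).congr fun n => ?_
  simp only [Function.comp]
  have h4 : -((2 * Real.pi) ^ 2 / ((n + 1 : ℕ) : ℝ)) * ‖ξ‖ ^ 2 =
      -((2 * Real.pi * ‖ξ‖) ^ 2 / ((n + 1 : ℕ) : ℝ)) := by ring
  rw [h4, Real.mul_rpow (by positivity) (sub_nonneg.2 ?_)]
  · congr 1
    ring
  · rw [Real.exp_le_one_iff]
    exact neg_nonpos.2 (by positivity)

theorem continuous_symbol {θ : ℝ} (hθ : 0 < θ) (t : ℝ) : Continuous (symbol θ t : V → ℝ) := by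
  unfold symbol
  exact Real.continuous_exp.comp (continuous_const.mul
    ((continuous_const.mul continuous_norm).rpow_const fun _ => Or.inr hθ.le))

theorem integrable_symbol [Nontrivial V] {θ t : ℝ} (hθ : 0 < θ) (ht : 0 < t) :
    Integrable (symbol θ t : V → ℝ) := by
  have h1 := integrableOn_rpow_mul_exp_neg_mul_rpow (p := θ)
    (s := ((Module.finrank ℝ V - 1 : ℕ) : ℝ)) (b := t * (2 * Real.pi) ^ θ)
    (by have : (0 : ℝ) ≤ ((Module.finrank ℝ V - 1 : ℕ) : ℝ) := Nat.cast_nonneg _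
        linarith) hθ (by positivity)
  refine (integrable_fun_norm_addHaar (volume : Measure V)
    (f := fun r => Real.exp (-t * (2 * Real.pi * r) ^ θ))).2 (h1.congr_fun (fun r hr => ?_)
      measurableSet_Ioi)
  simp only [Real.rpow_natCast, smul_eq_mul]
  rw [Real.mul_rpow (by positivity) (le_of_lt hr)]
  congr 2
  ring

theorem symbol_neg (θ t : ℝ) (ξ : V) : symbol θ t (-ξ) = symbol θ t ξ := by simp [symbol]

theorem symbol_mul (θ s t : ℝ) (ξ : V) : symbol θ t ξ * symbol θ s ξ = symbol θ (t + s) ξ := by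
  rw [symbol, symbol, symbol, ← Real.exp_add]
  congr 1
  ring

theorem symbol_zero {θ : ℝ} (hθ : 0 < θ) (t : ℝ) : symbol θ t (0 : V) = 1 := by
  simp [symbol, Real.zero_rpow hθ.ne']

variable [Nontrivial V] {θ t : ℝ}

theorem cosTransform_symbol_nonneg (hθ : 0 < θ) (hθ2 : θ ≤ 2) (ht : 0 < t) (x : V) :
    0 ≤ cosTransform (symbol θ t) x :=
  (posType_symbol hθ hθ2 ht.le).cosTransform_nonneg (integrable_symbol hθ ht) x

theorem integrable_cosTransform_symbol (hθ : 0 < θ) (hθ2 : θ ≤ 2) (ht : 0 < t) :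
    Integrable (cosTransform (symbol θ t : V → ℝ)) :=
  integrable_cosTransform_of_nonneg (integrable_symbol hθ ht) (symbol_le_one θ ht.le)
    (cosTransform_symbol_nonneg hθ hθ2 ht)

theorem cosTransform_cosTransform_symbol (hθ : 0 < θ) (hθ2 : θ ≤ 2) (ht : 0 < t) :
    cosTransform (cosTransform (symbol θ t : V → ℝ)) = symbol θ t :=
  cosTransform_cosTransform (integrable_symbol hθ ht) (continuous_symbol hθ t) (symbol_neg θ t)
    (integrable_cosTransform_symbol hθ hθ2 ht)

theorem integral_cosTransform_symbol (hθ : 0 < θ) (hθ2 : θ ≤ 2) (ht : 0 < t) :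
    ∫ x : V, cosTransform (symbol θ t) x = 1 := by
  have h1 := congrFun (cosTransform_cosTransform_symbol (V := V) hθ hθ2 ht) 0
  rw [symbol_zero hθ] at h1
  simpa [cosTransform] using h1

/-- After Fubini, expand $\cos(2\pi\xi\cdot(x-y))$: the sine part vanishes by parity, and inversion
turns the cosine part into the symbol at time $s$. Symbols multiply by adding times. -/
theorem integral_cosTransform_symbol_mul (hθ : 0 < θ) (hθ2 : θ ≤ 2) {s : ℝ} (ht : 0 < t)
    (hs : 0 < s) (x : V) :
    ∫ y, cosTransform (symbol θ t) (x - y) * cosTransform (symbol θ s) y =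
      cosTransform (symbol θ (t + s)) x := by
  have hg := integrable_cosTransform_symbol (V := V) hθ hθ2 hs
  have hh := integrable_symbol (V := V) hθ ht
  have hinv := cosTransform_cosTransform_symbol (V := V) hθ hθ2 hs
  set g : V → ℝ := cosTransform (symbol θ s) with hgdef
  have hinner : ∀ ξ : V, ∫ y, g y * Real.cos (2 * Real.pi * inner ℝ ξ (x - y)) =
      Real.cos (2 * Real.pi * inner ℝ ξ x) * symbol θ s ξ := by
    intro ξ
    have h1 : ∀ y : V, g y * Real.cos (2 * Real.pi * inner ℝ ξ (x - y)) =
        Real.cos (2 * Real.pi * inner ℝ ξ x) * (g y * Real.cos (2 * Real.pi * inner ℝ y ξ)) +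
        Real.sin (2 * Real.pi * inner ℝ ξ x) * (g y * Real.sin (2 * Real.pi * inner ℝ y ξ)) := by
      intro y
      rw [inner_sub_right, mul_sub, Real.cos_sub, real_inner_comm y ξ]
      ring
    simp only [h1]
    rw [integral_add ((integrable_mul_cos hg ξ).const_mul _)
      ((integrable_mul_sin hg ξ).const_mul _), integral_const_mul, integral_const_mul,
      integral_mul_sin_eq_zero (cosTransform_neg _), mul_zero, add_zero]
    exact congrArg _ (congrFun hinv ξ)
  have h2 : ∀ y, cosTransform (symbol θ t) (x - y) * g y =
      ∫ ξ, symbol θ t ξ * (g y * Real.cos (2 * Real.pi * inner ℝ ξ (x - y))) := by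
    intro y
    rw [cosTransform, ← integral_mul_const]
    refine integral_congr_ae (ae_of_all _ fun ξ => ?_)
    ring
  simp only [h2]
  rw [integral_integral_swap]
  · simp only [integral_const_mul, hinner, cosTransform]
    refine integral_congr_ae (ae_of_all _ fun ξ => ?_)
    simp only [← symbol_mul]
    ring
  · have h3 : Integrable (fun p : V × V => g p.1 * symbol θ t p.2) (volume.prod volume) :=
      hg.mul_prod hh
    refine (h3.mul_bdd (c := 1) (g := fun p => Real.cos (2 * Real.pi * inner ℝ p.2 (x - p.1)))
      (by fun_prop) (ae_of_all _ fun ξ => ?_)).congr (ae_of_all _ fun p => ?_)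
    · simpa using Real.abs_cos_le_one _
    · simp only [Function.uncurry]
      ring

end StableTransform

/-! ### The semigroup on $[0,\infty]$-valued functions; Jensen's inequality -/

section Semigroup

variable {N : ℕ}

theorem kernel_eq_cosTransform [NeZero N] {θ t : ℝ} (hθ : 0 < θ) (ht : 0 < t)
    (x : EuclideanSpace ℝ (Fin N)) : kernel θ x t = cosTransform (symbol θ t) x := by
  have h1 := fourierInv_ofReal_eq_cosTransform
    (integrable_symbol (V := EuclideanSpace ℝ (Fin N)) hθ ht) (symbol_neg θ t) x
  exact (congrArg Complex.re h1).trans (Complex.ofReal_re _)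

theorem measurable_kernel (θ : ℝ) :
    Measurable fun p : EuclideanSpace ℝ (Fin N) × ℝ => kernel θ p.1 p.2 := by
  simp only [kernel, Real.fourierInv_eq']
  refine Complex.measurable_re.comp (StronglyMeasurable.integral_prod_right' (f :=
    fun q : (EuclideanSpace ℝ (Fin N) × ℝ) × EuclideanSpace ℝ (Fin N) =>
      Complex.exp (↑(2 * Real.pi * inner ℝ q.2 q.1.1) * Complex.I) •
        ((Real.exp (-q.1.2 * (2 * Real.pi * ‖q.2‖) ^ θ) : ℝ) : ℂ)) ?_).measurable
  exact Measurable.stronglyMeasurable (by fun_prop)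

@[fun_prop]
theorem measurable_ofReal_kernel {α : Type*} [MeasurableSpace α] (θ : ℝ)
    {X : α → EuclideanSpace ℝ (Fin N)} {τ : α → ℝ} (hX : Measurable X) (hτ : Measurable τ) :
    Measurable fun a => ENNReal.ofReal (kernel θ (X a) (τ a)) :=
  ((measurable_kernel θ).comp (hX.prodMk hτ)).ennreal_ofReal

theorem lintegral_kernel [NeZero N] {θ t : ℝ} (hθ : 0 < θ) (hθ2 : θ ≤ 2) (ht : 0 < t)
    (x : EuclideanSpace ℝ (Fin N)) : ∫⁻ y, ENNReal.ofReal (kernel θ (x - y) t) = 1 := by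
  rw [lintegral_sub_left_eq_self (fun y => ENNReal.ofReal (kernel θ y t)) x]
  simp only [kernel_eq_cosTransform hθ ht]
  rw [← ofReal_integral_eq_lintegral_ofReal (integrable_cosTransform_symbol hθ hθ2 ht)
    (ae_of_all _ (cosTransform_symbol_nonneg hθ hθ2 ht)), integral_cosTransform_symbol hθ hθ2 ht,
    ENNReal.ofReal_one]

theorem lintegral_kernel_mul_kernel [NeZero N] {θ s t : ℝ} (hθ : 0 < θ) (hθ2 : θ ≤ 2)
    (ht : 0 < t) (hs : 0 < s) (x z : EuclideanSpace ℝ (Fin N)) :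
    ∫⁻ y, ENNReal.ofReal (kernel θ (x - y) t) * ENNReal.ofReal (kernel θ (y - z) s) =
      ENNReal.ofReal (kernel θ (x - z) (t + s)) := by
  rw [← lintegral_add_right_eq_self _ z]
  simp only [add_sub_cancel_right, kernel_eq_cosTransform hθ ht, kernel_eq_cosTransform hθ hs,
    kernel_eq_cosTransform hθ (add_pos ht hs)]
  have hnn := cosTransform_symbol_nonneg (V := EuclideanSpace ℝ (Fin N)) hθ hθ2 ht
  have hnn' := cosTransform_symbol_nonneg (V := EuclideanSpace ℝ (Fin N)) hθ hθ2 hs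
  have hi := integrable_symbol (V := EuclideanSpace ℝ (Fin N)) hθ ht
  simp only [← ENNReal.ofReal_mul (hnn _)]
  rw [← integral_cosTransform_symbol_mul hθ hθ2 ht hs (x - z)]
  simp only [sub_add_eq_sub_sub_swap]
  rw [← ofReal_integral_eq_lintegral_ofReal]
  · refine (integrable_cosTransform_symbol hθ hθ2 hs).bdd_mul
      (c := ∫ ξ : EuclideanSpace ℝ (Fin N), ‖symbol θ t ξ‖) ?_ (ae_of_all _ fun y => ?_)
    · exact ((continuous_cosTransform hi).comp (by fun_prop)).aestronglyMeasurable
    · refine (norm_integral_le_integral_norm _).trans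
        (integral_mono (integrable_mul_cos hi _).norm hi.norm fun ξ => ?_)
      simp only [norm_mul]
      exact mul_le_of_le_one_right (norm_nonneg _) (by simpa using Real.abs_cos_le_one _)
  · exact ae_of_all _ fun y => mul_nonneg (hnn _) (hnn' _)

theorem semigroup_congr_ae (θ t : ℝ) {φ ψ : EuclideanSpace ℝ (Fin N) → ℝ≥0∞} (h : φ =ᵐ[volume] ψ) :
    semigroup θ t φ = semigroup θ t ψ := by
  funext x
  refine lintegral_congr_ae ?_
  filter_upwards [h] with y hy
  rw [hy]

theorem semigroup_mono (θ t : ℝ) {φ ψ : EuclideanSpace ℝ (Fin N) → ℝ≥0∞} (h : φ ≤ ψ) :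
    semigroup θ t φ ≤ semigroup θ t ψ :=
  fun _ => lintegral_mono fun y => mul_le_mul_right (h y) _

theorem semigroup_add (θ t : ℝ) {φ : EuclideanSpace ℝ (Fin N) → ℝ≥0∞} (hφ : Measurable φ)
    (ψ : EuclideanSpace ℝ (Fin N) → ℝ≥0∞) (x : EuclideanSpace ℝ (Fin N)) :
    semigroup θ t (fun y => φ y + ψ y) x = semigroup θ t φ x + semigroup θ t ψ x := by
  simp only [semigroup, mul_add]
  exact lintegral_add_left (by fun_prop) _

theorem measurable_semigroup {α : Type*} [MeasurableSpace α] (θ : ℝ)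
    {φ : EuclideanSpace ℝ (Fin N) × α → ℝ≥0∞} (hφ : Measurable φ)
    {X : α → EuclideanSpace ℝ (Fin N)} {τ : α → ℝ} (hX : Measurable X) (hτ : Measurable τ) :
    Measurable fun a => semigroup θ (τ a) (fun y => φ (y, a)) (X a) := by
  refine Measurable.lintegral_prod_right' (f := fun p : α × EuclideanSpace ℝ (Fin N) =>
    ENNReal.ofReal (kernel θ (X p.1 - p.2) (τ p.1)) * φ (p.2, p.1)) ?_
  fun_prop

theorem semigroup_semigroup [NeZero N] {θ s t : ℝ} (hθ : 0 < θ) (hθ2 : θ ≤ 2) (ht : 0 < t)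
    (hs : 0 < s) {φ : EuclideanSpace ℝ (Fin N) → ℝ≥0∞} (hφ : Measurable φ)
    (x : EuclideanSpace ℝ (Fin N)) :
    semigroup θ t (semigroup θ s φ) x = semigroup θ (t + s) φ x := by
  have h1 : ∀ y, ENNReal.ofReal (kernel θ (x - y) t) * semigroup θ s φ y =
      ∫⁻ z, ENNReal.ofReal (kernel θ (x - y) t) *
        ENNReal.ofReal (kernel θ (y - z) s) * φ z := by
    intro y
    rw [semigroup, ← lintegral_const_mul _ (by fun_prop)]
    simp only [mul_assoc]
  rw [semigroup]
  simp only [h1]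
  rw [lintegral_lintegral_swap (by unfold Function.uncurry; fun_prop)]
  refine lintegral_congr fun z => ?_
  rw [lintegral_mul_const _ (by fun_prop), lintegral_kernel_mul_kernel hθ hθ2 ht hs]

theorem semigroup_setLIntegral {θ τ : ℝ} {I : Set ℝ} {ψ : EuclideanSpace ℝ (Fin N) × ℝ → ℝ≥0∞}
    (hψ : Measurable ψ) (x : EuclideanSpace ℝ (Fin N)) :
    semigroup θ τ (fun y => ∫⁻ r in I, ψ (y, r)) x =
      ∫⁻ r in I, semigroup θ τ (fun y => ψ (y, r)) x := by
  simp only [semigroup]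
  rw [lintegral_lintegral_swap (by unfold Function.uncurry; fun_prop)]
  refine lintegral_congr fun y => ?_
  rw [lintegral_const_mul _ (by fun_prop)]

theorem ofReal_map_lintegral_le {α : Type*} [MeasurableSpace α] {P : Measure α}
    [IsProbabilityMeasure P] {g : ℝ → ℝ} (hg : ConvexOn ℝ univ g) (hc : Continuous g)
    (h0 : ∀ v, 0 ≤ g v) {φ : α → ℝ≥0∞} (hφ : Measurable φ) (hfin : ∫⁻ a, φ a ∂P ≠ ∞) :
    ENNReal.ofReal (g (∫⁻ a, φ a ∂P).toReal) ≤ ∫⁻ a, ENNReal.ofReal (g (φ a).toReal) ∂P := by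
  by_cases hi : ∫⁻ a, ENNReal.ofReal (g (φ a).toReal) ∂P = ∞
  · rw [hi]
    exact le_top
  have hint : Integrable (fun a => g (φ a).toReal) P := by
    refine ⟨(hc.measurable.comp hφ.ennreal_toReal).aestronglyMeasurable, ?_⟩
    rw [hasFiniteIntegral_iff_ofReal (ae_of_all _ fun a => h0 _)]
    exact lt_top_iff_ne_top.2 hi
  rw [← ofReal_integral_eq_lintegral_ofReal hint (ae_of_all _ fun a => h0 _),
    ← integral_toReal hφ.aemeasurable (ae_lt_top hφ hfin)]
  exact ENNReal.ofReal_le_ofReal (hg.map_integral_le hc.continuousOn isClosed_univ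
    (ae_of_all _ fun _ => mem_univ _) (integrable_toReal_of_lintegral_ne_top hφ.aemeasurable hfin)
    hint)

/-- Jensen's inequality for the semigroup. -/
theorem ofReal_map_semigroup_le [NeZero N] {θ t : ℝ} (hθ : 0 < θ) (hθ2 : θ ≤ 2) (ht : 0 < t)
    {g : ℝ → ℝ} (hg : ConvexOn ℝ univ g) (hc : Continuous g) (h0 : ∀ v, 0 ≤ g v)
    {φ : EuclideanSpace ℝ (Fin N) → ℝ≥0∞} (hφ : Measurable φ) (x : EuclideanSpace ℝ (Fin N))
    (hfin : semigroup θ t φ x ≠ ∞) :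
    ENNReal.ofReal (g (semigroup θ t φ x).toReal) ≤
      semigroup θ t (fun y => ENNReal.ofReal (g (φ y).toReal)) x := by
  have hk : Measurable fun y => ENNReal.ofReal (kernel θ (x - y) t) := by fun_prop
  -- Nonnegativity and unit mass of the kernel make this a probability measure, so $[S(t)\psi](x)$
  -- is an expectation.
  let P : Measure (EuclideanSpace ℝ (Fin N)) :=
    volume.withDensity fun y => ENNReal.ofReal (kernel θ (x - y) t)
  have hP : ∀ ψ : EuclideanSpace ℝ (Fin N) → ℝ≥0∞, Measurable ψ →
      semigroup θ t ψ x = ∫⁻ y, ψ y ∂P := fun ψ hψ =>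
    (lintegral_withDensity_eq_lintegral_mul _ hk hψ).symm
  have : IsProbabilityMeasure P := ⟨by
    rw [withDensity_apply _ MeasurableSet.univ, setLIntegral_univ, lintegral_kernel hθ hθ2 ht]⟩
  have hgφ : Measurable fun y => ENNReal.ofReal (g (φ y).toReal) :=
    (hc.measurable.comp hφ.ennreal_toReal).ennreal_ofReal
  rw [hP _ hgφ]
  rw [hP _ hφ] at hfin ⊢
  exact ofReal_map_lintegral_le hg hc h0 hφ hfin

end Semigroup

/-! ### Comparison with the ordinary differential equation $y'=g(y)$ -/

section Comparison

/-- A supersolution `H = a + ∫ J` of `y' = g(y)` which stays finite up to time `t` forces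
`t ≤ ∫ₐ^∞ 1 / g`. -/
theorem ofReal_le_lintegral_of_supersolution {g : ℝ → ℝ} (hc : Continuous g) (hmono : Monotone g)
    {a : ℝ≥0∞} {J : ℝ → ℝ≥0∞} (hJ : Measurable J) {t : ℝ} (ht : 0 < t)
    (hfin : a + ∫⁻ r in Ioo 0 t, J r ≠ ∞) (hpos : 0 < g a.toReal)
    (hsup : ∀ᵐ s ∂(volume.restrict (Ioo 0 t)),
      ENNReal.ofReal (g (a + ∫⁻ r in Ioo 0 s, J r).toReal) ≤ J s) :
    ENNReal.ofReal t ≤ ∫⁻ s in Ioi a.toReal, (ENNReal.ofReal (g s))⁻¹ := by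
  obtain ⟨ha, hJfin⟩ := ENNReal.add_ne_top.1 hfin
  set α := a.toReal with hα
  have hJI : IntegrableOn (fun r => (J r).toReal) (Ioo 0 t) :=
    integrable_toReal_of_lintegral_ne_top hJ.aemeasurable hJfin
  let j : ℝ → ℝ := (Ioo 0 t).indicator fun r => (J r).toReal
  have hj : Integrable j := hJI.integrable_indicator measurableSet_Ioo
  have hj0 : ∀ r, 0 ≤ j r := fun r =>
    indicator_nonneg (f := fun r => (J r).toReal) (fun _ _ => ENNReal.toReal_nonneg) r
  let H : ℝ → ℝ := fun s => α + ∫ r in (0 : ℝ)..s, j r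
  have hHc : Continuous H := continuous_const.add
    (intervalIntegral.continuous_primitive (fun _ _ => hj.intervalIntegrable) 0)
  have hJlt : ∀ᵐ r ∂(volume.restrict (Ioo 0 t)), J r < ∞ := ae_lt_top hJ hJfin
  have hH : ∀ s ∈ Ioo 0 t, (a + ∫⁻ r in Ioo 0 s, J r).toReal = H s := by
    intro s hs
    have hsub : Ioo 0 s ⊆ Ioo 0 t := Ioo_subset_Ioo_right hs.2.le
    have hne : ∫⁻ r in Ioo 0 s, J r ≠ ∞ :=
      ne_top_of_le_ne_top hJfin (lintegral_mono_set hsub)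
    rw [ENNReal.toReal_add ha hne, ← integral_toReal hJ.aemeasurable (ae_lt_top hJ hne)]
    simp only [H, intervalIntegral.integral_of_le hs.1.le, integral_Ioc_eq_integral_Ioo]
    congr 1
    refine setIntegral_congr_fun measurableSet_Ioo fun r hr => ?_
    exact (indicator_of_mem (hsub hr) fun r => (J r).toReal).symm
  have hle : ∀ᵐ s, s ∈ Ioo 0 t → g (H s) ≤ j s := by
    rw [ae_restrict_iff' measurableSet_Ioo] at hsup hJlt
    filter_upwards [hsup, hJlt] with s h1 h2 hs
    have h3 := h1 hs
    rw [hH s hs, ENNReal.ofReal_le_iff_le_toReal (h2 hs).ne] at h3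
    simpa [j, hs] using h3
  -- $H$ is only a primitive of an integrable function. $K$ is $C^1$ with $K\le H$ on $(0,t)$, so
  -- monotonicity of $g$ gives $K'=g(H)\ge g(K)$ there.
  let K : ℝ → ℝ := fun s => α + ∫ r in (0 : ℝ)..s, g (H r)
  have hgH : Continuous fun r => g (H r) := hc.comp hHc
  have hKd : ∀ s, HasDerivAt K (g (H s)) s := fun s =>
    ((hgH.integral_hasStrictDerivAt 0 s).hasDerivAt).const_add α
  have hHα : ∀ s, 0 ≤ s → α ≤ H s := fun s hs =>
    le_add_of_nonneg_right (intervalIntegral.integral_nonneg hs fun r _ => hj0 r)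
  have hgpos : ∀ v, α ≤ v → 0 < g v := fun v hv => hpos.trans_le (hmono hv)
  have hKα : ∀ s, 0 ≤ s → α ≤ K s := fun s hs => le_add_of_nonneg_right
    (intervalIntegral.integral_nonneg hs fun r hr => (hgpos _ (hHα r hr.1)).le)
  have hKH : ∀ s ∈ Ioo 0 t, K s ≤ H s := by
    intro s hs
    refine add_le_add_right ?_ α
    refine intervalIntegral.integral_mono_ae_restrict hs.1.le (hgH.intervalIntegrable _ _)
      hj.intervalIntegrable ?_
    have h0 : ∀ᵐ r : ℝ, r ≠ 0 := by simp [ae_iff]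
    refine (ae_restrict_iff' measurableSet_Icc).2 ?_
    filter_upwards [hle, h0] with r hr hr0 hrs
    exact hr ⟨lt_of_le_of_ne hrs.1 hr0.symm, hrs.2.trans_lt hs.2⟩
  -- Freezing $1/g$ below $\alpha$ makes it continuous on the whole line. Its primitive $\Phi$
  -- satisfies $(\Phi\circ K)'\ge1$ on $(0,t)$, hence $\Phi(K(t))\ge t$.
  let q : ℝ → ℝ := fun v => (g (max v α))⁻¹
  have hqc : Continuous q := (hc.comp (continuous_id.max continuous_const)).inv₀ fun v =>
    (hgpos _ (le_max_right _ _)).ne'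
  have hq0 : ∀ v, 0 ≤ q v := fun v => inv_nonneg.2 (hgpos _ (le_max_right _ _)).le
  let Φ : ℝ → ℝ := fun y => ∫ v in α..y, q v
  have hΦd : ∀ y, HasDerivAt Φ (q y) y := fun y =>
    (hqc.integral_hasStrictDerivAt α y).hasDerivAt
  have hM : ∀ s, HasDerivAt (fun s => Φ (K s) - s) (q (K s) * g (H s) - 1) s := fun s =>
    ((hΦd (K s)).comp s (hKd s)).sub (hasDerivAt_id s)
  have hmonoM : MonotoneOn (fun s => Φ (K s) - s) (Icc 0 t) := by
    refine monotoneOn_of_deriv_nonneg (convex_Icc 0 t)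
      (fun s _ => (hM s).continuousAt.continuousWithinAt)
      (fun s _ => (hM s).differentiableAt.differentiableWithinAt) fun s hs => ?_
    rw [interior_Icc] at hs
    have hKs := hKα s hs.1.le
    have h1 : g (K s) ≤ g (H s) := hmono (hKH s hs)
    have h2 := hgpos _ hKs
    rw [(hM s).deriv]
    simp only [q, max_eq_left hKs]
    rw [sub_nonneg, inv_mul_eq_div, one_le_div h2]
    exact h1
  have hfinal := hmonoM (left_mem_Icc.2 ht.le) (right_mem_Icc.2 ht.le) ht.le
  have hK0 : K 0 = α := by simp [K]
  simp only [hK0, sub_zero] at hfinal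
  have hΦα : Φ α = 0 := by simp [Φ]
  rw [hΦα, sub_nonneg] at hfinal
  calc ENNReal.ofReal t ≤ ENNReal.ofReal (Φ (K t)) := ENNReal.ofReal_le_ofReal hfinal
    _ = ∫⁻ v in Ioc α (K t), ENNReal.ofReal (q v) := by
        simp only [Φ]
        rw [intervalIntegral.integral_of_le (hKα t ht.le), ofReal_integral_eq_lintegral_ofReal
          (hqc.integrableOn_Ioc) (ae_of_all _ hq0)]
    _ ≤ ∫⁻ v in Ioi α, ENNReal.ofReal (q v) := lintegral_mono_set Ioc_subset_Ioi_self
    _ = ∫⁻ s in Ioi α, (ENNReal.ofReal (g s))⁻¹ := by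
        refine setLIntegral_congr_fun measurableSet_Ioi fun v hv => ?_
        have hv' : α ≤ v := le_of_lt (mem_Ioi.1 hv)
        simp only [q, max_eq_left hv']
        exact ENNReal.ofReal_inv_of_pos (hgpos v hv')

end Comparison

/-! ### Convex truncation and growth of $f$ -/

section Nonlinearity

variable {f : ℝ → ℝ}

/-- Otherwise $f<2f(\tau)$ on $[\tau,\infty)$, and $1/f$ would not be integrable at infinity. -/
theorem CondM.exists_two_mul_le (hM : CondM f) (hS : CondS f) {τ : ℝ} (hτ : 0 < τ) :
    ∃ τ', τ ≤ τ' ∧ 2 * f τ ≤ f τ' := by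
  by_contra! hlt
  obtain ⟨τ₀, -, -, hint⟩ := hS
  have hc : 0 < 2 * f τ := by have := hM.pos τ hτ; positivity
  have h1 : IntegrableOn (fun _ : ℝ => 1 / (2 * f τ)) (Ioi (max τ τ₀)) := by
    refine Integrable.mono' (hint.mono_set (Ioi_subset_Ioi (le_max_right τ τ₀)))
      aestronglyMeasurable_const ((ae_restrict_iff' measurableSet_Ioi).2 (ae_of_all _ fun s hs => ?_))
    have hs' : τ < s := (le_max_left _ _).trans_lt hs
    rw [Real.norm_of_nonneg (by positivity)]
    exact one_div_le_one_div_of_le (hM.pos s (hτ.trans hs')) (hlt s hs'.le).le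
  rw [integrableOn_const_iff] at h1
  rcases h1 with h1 | h1
  · exact (one_div_pos.2 hc).ne' (by simpa using h1)
  · simp at h1

/-- A nondecreasing convex function composed with the convex map $u\mapsto\max(u,\tau)$. Subtracting
$f(\tau)$ makes the truncation vanish below $\tau$, which keeps it under $f$ there. -/
theorem CondM.convexOn_truncation (hM : CondM f) {τ : ℝ} (hτ : 0 ≤ τ)
    (hC : ConvexOn ℝ (Ici τ) f) : ConvexOn ℝ univ fun u => f (max u τ) - f τ := by
  refine ⟨convex_univ, fun x _ y _ a b ha hb hab => ?_⟩
  have hx : max x τ ∈ Ici τ := mem_Ici.2 (le_max_right _ _)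
  have hy : max y τ ∈ Ici τ := mem_Ici.2 (le_max_right _ _)
  have hz : a • max x τ + b • max y τ ∈ Ici τ := convex_Ici τ hx hy ha hb hab
  have h1 : max (a • x + b • y) τ ≤ a • max x τ + b • max y τ := by
    refine max_le ?_ hz
    simp only [smul_eq_mul]
    gcongr <;> exact le_max_left _ _
  have h2 := hM.monotoneOn (hτ.trans (le_max_right (a • x + b • y) τ)) (hτ.trans hz) h1
  have h3 := hC.2 hx hy ha hb hab
  simp only [smul_eq_mul] at h2 h3 ⊢
  have h4 : a * f τ + b * f τ = f τ := by rw [← add_mul, hab, one_mul]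
  linarith

theorem CondM.continuous_comp_max (hM : CondM f) {τ : ℝ} (hτ : 0 ≤ τ) :
    Continuous fun u => f (max u τ) :=
  hM.continuousOn.comp_continuous (by fun_prop) fun u => hτ.trans (le_max_right _ _)

theorem CondM.monotone_comp_max (hM : CondM f) {τ : ℝ} (hτ : 0 ≤ τ) :
    Monotone fun u => f (max u τ) := fun _ _ huv =>
  hM.monotoneOn (hτ.trans (le_max_right _ _)) (hτ.trans (le_max_right _ _))
    (max_le_max_right _ huv)

theorem CondM.ofReal_le_F (hM : CondM f) {a b : ℝ} (ha : 0 ≤ a) (hab : a ≤ b) :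
    ENNReal.ofReal (1 / f (b + 1)) ≤ F f a := by
  have hb : 0 ≤ b := ha.trans hab
  have hf := hM.pos (b + 1) (by linarith)
  calc ENNReal.ofReal (1 / f (b + 1))
      = ∫⁻ _ in Ioc b (b + 1), (ENNReal.ofReal (f (b + 1)))⁻¹ := by
        rw [setLIntegral_const, Real.volume_Ioc, add_sub_cancel_left, ENNReal.ofReal_one, mul_one,
          one_div, ENNReal.ofReal_inv_of_pos hf]
    _ ≤ ∫⁻ s in Ioc b (b + 1), (ENNReal.ofReal (f s))⁻¹ :=
        setLIntegral_mono' measurableSet_Ioc fun s hs => ENNReal.inv_le_inv.2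
          (ENNReal.ofReal_le_ofReal (hM.monotoneOn (hb.trans hs.1.le) (by simp; linarith) hs.2))
    _ ≤ F f a := lintegral_mono_set fun s hs => hab.trans_lt hs.1

end Nonlinearity

/-! ### The differential inequality along a solution -/

section Solutions

variable {N : ℕ}

theorem volume_restrict_cylinder (N : ℕ) (T : ℝ) :
    volume.restrict (cylinder N T) =
      (volume : Measure (EuclideanSpace ℝ (Fin N))).prod (volume.restrict (Ioo 0 T)) := by
  rw [cylinder, Measure.volume_eq_prod, ← Measure.prod_restrict, Measure.restrict_univ]

theorem ae_ae_of_ae_cylinder {T : ℝ} {p : EuclideanSpace ℝ (Fin N) × ℝ → Prop}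
    (h : ∀ᵐ q ∂(volume.restrict (cylinder N T)), p q) :
    ∀ᵐ t ∂(volume.restrict (Ioo 0 T)), ∀ᵐ x, p (x, t) := by
  rw [volume_restrict_cylinder] at h
  exact Measure.ae_ae_of_ae_prod
    ((Measure.measurePreserving_swap (μ := volume.restrict (Ioo 0 T))
      (ν := (volume : Measure (EuclideanSpace ℝ (Fin N))))).quasiMeasurePreserving.ae h)

/-- Along a solution, `s ↦ S(t - s) u(s)` is an integrated supersolution of an ordinary
differential equation. -/
theorem ofReal_le_lintegral_of_solution [NeZero N] {θ : ℝ} (hθ : 0 < θ) (hθ2 : θ ≤ 2)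
    {f g : ℝ → ℝ} (hM : CondM f) (hg : ConvexOn ℝ univ g) (hc : Continuous g) (hmono : Monotone g)
    (h0 : ∀ v, 0 ≤ g v) (hgf : ∀ v, 0 ≤ v → g v ≤ f v)
    {m : EuclideanSpace ℝ (Fin N) → ℝ≥0∞} (hm : Measurable m)
    {v : EuclideanSpace ℝ (Fin N) × ℝ → ℝ≥0∞} (hv : Measurable v) {T : ℝ}
    (heq : ∀ᵐ s ∂(volume.restrict (Ioo 0 T)), ∀ᵐ y, v (y, s) = semigroup θ s m y +
      ∫⁻ r in Ioo 0 s, semigroup θ (s - r) (fun z => ENNReal.ofReal (f (v (z, r)).toReal)) y)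
    {x : EuclideanSpace ℝ (Fin N)} {t : ℝ} (ht : t ∈ Ioo 0 T)
    (hfin : semigroup θ t m x + ∫⁻ r in Ioo 0 t,
      semigroup θ (t - r) (fun z => ENNReal.ofReal (f (v (z, r)).toReal)) x ≠ ∞)
    (hpos : 0 < g (semigroup θ t m x).toReal) :
    ENNReal.ofReal t ≤ ∫⁻ s in Ioi (semigroup θ t m x).toReal, (ENNReal.ofReal (g s))⁻¹ := by
  have hφ : Measurable fun p : EuclideanSpace ℝ (Fin N) × ℝ =>
      ENNReal.ofReal (f (v p).toReal) := by
    have h1 := ((hM.continuous_comp_max le_rfl).measurable.comp hv.ennreal_toReal).ennreal_ofReal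
    simpa only [Function.comp, max_eq_left ENNReal.toReal_nonneg] using h1
  have hφs : ∀ r, Measurable fun z => ENNReal.ofReal (f (v (z, r)).toReal) := fun r =>
    hφ.comp (measurable_id.prodMk measurable_const)
  refine ofReal_le_lintegral_of_supersolution hc hmono
    (measurable_semigroup θ hφ measurable_const (by fun_prop)) ht.1 hfin hpos ?_
  have hsub : Ioo 0 t ⊆ Ioo 0 T := Ioo_subset_Ioo_right ht.2.le
  filter_upwards [ae_restrict_of_ae_restrict_of_subset hsub heq,
    ae_restrict_mem measurableSet_Ioo] with s hs hst
  have hts : 0 < t - s := sub_pos.2 hst.2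
  -- $S(t-s)$ needs the equation only for a.e. $y$, so $x$ may be any point where the right side is
  -- finite at time $t$. Tonelli and the semigroup law replace $s-r$ by $t-r$.
  have hW : semigroup θ (t - s) (fun y => v (y, s)) x = semigroup θ t m x + ∫⁻ r in Ioo 0 s,
      semigroup θ (t - r) (fun z => ENNReal.ofReal (f (v (z, r)).toReal)) x := by
    have hψ : Measurable fun p : EuclideanSpace ℝ (Fin N) × ℝ =>
        semigroup θ (s - p.2) (fun z => ENNReal.ofReal (f (v (z, p.2)).toReal)) p.1 :=
      measurable_semigroup θ (φ := fun q : EuclideanSpace ℝ (Fin N) ×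
        (EuclideanSpace ℝ (Fin N) × ℝ) => ENNReal.ofReal (f (v (q.1, q.2.2)).toReal))
        (hφ.comp (by fun_prop : Measurable fun q : EuclideanSpace ℝ (Fin N) ×
        (EuclideanSpace ℝ (Fin N) × ℝ) => (q.1, q.2.2))) measurable_fst (by fun_prop)
    have hSm : Measurable (semigroup θ s m) :=
      measurable_semigroup θ (φ := fun q : EuclideanSpace ℝ (Fin N) × EuclideanSpace ℝ (Fin N) =>
        m q.1) (by fun_prop) measurable_id measurable_const
    rw [semigroup_congr_ae θ (t - s) hs, semigroup_add θ _ hSm, semigroup_setLIntegral hψ,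
      semigroup_semigroup hθ hθ2 hts hst.1 hm, sub_add_cancel]
    congr 1
    refine setLIntegral_congr_fun measurableSet_Ioo fun r hr => ?_
    have h1 := semigroup_semigroup hθ hθ2 hts (sub_pos.2 hr.2) (hφs r) x
    rwa [sub_add_sub_cancel] at h1
  have hWfin : semigroup θ (t - s) (fun y => v (y, s)) x ≠ ∞ := by
    rw [hW]
    refine ne_top_of_le_ne_top hfin ?_
    gcongr
    exact hst.2.le
  rw [← hW]
  refine (ofReal_map_semigroup_le hθ hθ2 hts hg hc h0
    (hv.comp (measurable_id.prodMk measurable_const)) x hWfin).trans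
    (semigroup_mono θ (t - s) (fun y => ?_) x)
  exact ENNReal.ofReal_le_ofReal (hgf _ ENNReal.toReal_nonneg)

end Solutions

end FracHeat

end

/-! ### Choice of constants and conclusion -/

theorem mainTheorem5 (f : ℝ → ℝ) (hM : FracHeat.CondM f) (hS : FracHeat.CondS f)
    (hC : FracHeat.CondC f) :
    ∃ Cstar T₀ : ℝ, 0 < Cstar ∧ Cstar < 1 ∧ 0 < T₀ ∧
      ∀ (N : ℕ) (θ : ℝ) (μ : EuclideanSpace ℝ (Fin N) → ℝ) (T : ℝ),
        1 ≤ N → 0 < θ → θ ≤ 2 → FracHeat.IsInitialDatum μ → 0 < T →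
        FracHeat.SolvableIn θ f μ T →
        ∀ᵐ p ∂(volume.restrict (FracHeat.cylinder N (min T T₀))),
          FracHeat.semigroup θ p.2 (fun y => ENNReal.ofReal (μ y)) p.1 < ∞ ∧
          ENNReal.ofReal (Cstar * p.2) ≤
            FracHeat.F f
              (FracHeat.semigroup θ p.2 (fun y => ENNReal.ofReal (μ y)) p.1).toReal := by
  obtain ⟨τ₁, -, hconv⟩ := hC
  set τ := max τ₁ 1
  have hτ : 0 < τ := one_pos.trans_le (le_max_right _ _)
  have hconvτ : ConvexOn ℝ (Ici τ) f :=
    hconv.subset (Ici_subset_Ici.2 (le_max_left _ _)) (convex_Ici _)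
  obtain ⟨τ₂, hττ₂, hf2⟩ := hM.exists_two_mul_le hS hτ
  have hτ₂ : 0 < τ₂ := hτ.trans_le hττ₂
  let g : ℝ → ℝ := fun u => f (max u τ) - f τ
  have hgc : Continuous g := (hM.continuous_comp_max hτ.le).sub continuous_const
  have hgm : Monotone g := fun _ _ huv => sub_le_sub_right (hM.monotone_comp_max hτ.le huv) _
  have hg0 : ∀ v, 0 ≤ g v := fun v =>
    sub_nonneg.2 (hM.monotoneOn hτ.le (hτ.le.trans (le_max_right _ _)) (le_max_right _ _))
  have hgf : ∀ v, 0 ≤ v → g v ≤ f v := by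
    intro v hv
    rcases le_total v τ with h | h
    · simpa [g, max_eq_right h] using hM.nonneg v hv
    · simpa [g, max_eq_left h] using hM.nonneg τ hτ.le
  have hfg : ∀ v, τ₂ ≤ v → f v / 2 ≤ g v := by
    intro v hv
    have h1 := hM.monotoneOn hτ₂.le (hτ₂.le.trans hv) hv
    simp only [g, max_eq_left (hττ₂.trans hv)]
    linarith
  have hfτ₂ : 0 < f (τ₂ + 1) := hM.pos _ (by linarith)
  -- $C_*=1/2$ is forced by $g\ge f/2$; $T_0$ is chosen so that $C_*T_0=1/f(\tau_2+1)$, the lower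
  -- bound for $F$ on $[0,\tau_2]$.
  refine ⟨1 / 2, 2 / f (τ₂ + 1), by norm_num, by norm_num, by positivity, ?_⟩
  intro N θ μ T hN hθ hθ2 hμ hT ⟨u, hu⟩
  have : NeZero N := ⟨by omega⟩
  obtain ⟨v, hv, huv⟩ := hu.aemeasurable
  obtain ⟨m, hm, hμm⟩ := hμ.1.aestronglyMeasurable.aemeasurable.ennreal_ofReal
  have hSm : ∀ t, FracHeat.semigroup θ t (fun y => ENNReal.ofReal (μ y)) =
    FracHeat.semigroup θ t m := fun t => FracHeat.semigroup_congr_ae θ t hμm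
  -- Replacing $u$ by a measurable representative leaves the Duhamel term unchanged at every
  -- $(x,t)$, as almost every time slice agrees a.e.
  have hint : ∀ (x : EuclideanSpace ℝ (Fin N)) (t : ℝ), t ∈ Ioo 0 T →
      ∫⁻ r in Ioo 0 t,
        FracHeat.semigroup θ (t - r) (fun y => ENNReal.ofReal (f (u (y, r)).toReal)) x =
      ∫⁻ r in Ioo 0 t,
        FracHeat.semigroup θ (t - r) (fun y => ENNReal.ofReal (f (v (y, r)).toReal)) x := by
    intro x t ht
    refine lintegral_congr_ae ?_
    filter_upwards [ae_restrict_of_ae_restrict_of_subset (Ioo_subset_Ioo_right ht.2.le)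
      (FracHeat.ae_ae_of_ae_cylinder huv)] with r hr
    refine congrFun (FracHeat.semigroup_congr_ae θ (t - r) ?_) x
    filter_upwards [hr] with y hy
    rw [hy]
  have hmem : MeasurableSet (FracHeat.cylinder N T) := MeasurableSet.univ.prod measurableSet_Ioo
  have heq : ∀ᵐ p ∂(volume.restrict (FracHeat.cylinder N T)),
      v p = FracHeat.semigroup θ p.2 m p.1 + ∫⁻ r in Ioo 0 p.2, FracHeat.semigroup θ (p.2 - r)
        (fun y => ENNReal.ofReal (f (v (y, r)).toReal)) p.1 := by
    filter_upwards [hu.eq, huv, ae_restrict_mem hmem] with p h1 h2 h3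
    rw [← h2, h1, hSm, hint p.1 p.2 h3.2]
  have hsub : FracHeat.cylinder N (min T (2 / f (τ₂ + 1))) ⊆ FracHeat.cylinder N T :=
    prod_mono Subset.rfl (Ioo_subset_Ioo_right (min_le_left _ _))
  filter_upwards [ae_restrict_of_ae_restrict_of_subset hsub heq,
    ae_restrict_of_ae_restrict_of_subset hsub huv,
    ae_restrict_of_ae_restrict_of_subset hsub hu.finite,
    ae_restrict_mem (MeasurableSet.univ.prod measurableSet_Ioo)] with p h1 h2 h3 h4
  rw [hSm]
  rw [h2, h1] at h3
  obtain ⟨-, ht0, htT⟩ := h4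
  obtain ⟨htT, htT₀⟩ := lt_min_iff.1 htT
  refine ⟨lt_of_le_of_lt le_self_add h3, ?_⟩
  rcases le_total (FracHeat.semigroup θ p.2 m p.1).toReal τ₂ with ha | ha
  · refine le_trans (ENNReal.ofReal_le_ofReal ?_) (hM.ofReal_le_F ENNReal.toReal_nonneg ha)
    have h5 : (1 : ℝ) / f (τ₂ + 1) = 1 / 2 * (2 / f (τ₂ + 1)) := by ring
    rw [h5]
    gcongr
  · have hgpos : ∀ w, τ₂ ≤ w → 0 < f w / 2 := fun w hw => half_pos (hM.pos w (hτ₂.trans_le hw))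
    have h5 := FracHeat.ofReal_le_lintegral_of_solution hθ hθ2 hM
      (hM.convexOn_truncation hτ.le hconvτ) hgc hgm hg0 hgf hm hv
      (FracHeat.ae_ae_of_ae_cylinder heq) ⟨ht0, htT⟩ h3.ne ((hgpos _ ha).trans_le (hfg _ ha))
    have h6 : ∫⁻ s in Ioi (FracHeat.semigroup θ p.2 m p.1).toReal, (ENNReal.ofReal (g s))⁻¹ ≤
        2 * FracHeat.F f (FracHeat.semigroup θ p.2 m p.1).toReal := by
      rw [FracHeat.F, ← lintegral_const_mul' _ _ ENNReal.ofNat_ne_top]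
      refine setLIntegral_mono' measurableSet_Ioi fun s hs => ?_
      have hs' : τ₂ ≤ s := ha.trans (le_of_lt (mem_Ioi.1 hs))
      have hfs : 0 < f s := hM.pos s (hτ₂.trans_le hs')
      rw [← ENNReal.ofReal_inv_of_pos ((hgpos s hs').trans_le (hfg s hs')),
        ← ENNReal.ofReal_inv_of_pos hfs, ← ENNReal.ofReal_ofNat 2,
        ← ENNReal.ofReal_mul zero_le_two]
      refine ENNReal.ofReal_le_ofReal ?_
      have h7 := inv_anti₀ (hgpos s hs') (hfg s hs')
      rwa [inv_div, div_eq_mul_inv] at h7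
    rw [ENNReal.ofReal_mul (by norm_num)]
    calc ENNReal.ofReal (1 / 2) * ENNReal.ofReal p.2
        ≤ ENNReal.ofReal (1 / 2) *
          (2 * FracHeat.F f (FracHeat.semigroup θ p.2 m p.1).toReal) := by
          gcongr
          exact h5.trans h6
      _ = FracHeat.F f (FracHeat.semigroup θ p.2 m p.1).toReal := by
          rw [← mul_assoc, ← ENNReal.ofReal_ofNat 2, ← ENNReal.ofReal_mul (by norm_num)]
          norm_num
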